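/- Let $(X,\mathbf d)$ be a metric space, $\mathbf 0\in X$, $\Gamma\subset X$, $g:\Gamma\to\mathbb R_+$ and $K:\mathcal P(X)\times X\to\mathbb R_+$, where $\mathcal P(\cdot)$ denotes the set of Borel probability measures with the topology of weak convergence. Let $\mathcal C_X=C(\mathbb R_+,X)$ carry the topology of uniform convergence on compact sets and its Borel $\sigma$-algebra, let $e_t(\gamma)=\gamma(t)$, and let $|\dot\gamma|(t)=\lim_{s\to t}\mathbf d(\gamma(s),\gamma(t))/|s-t|$ be the metric derivative. Assume: - (H1) for every $R>0$ the closed ball $\overline B_X(\mathbf 0,R)$ is compact; - (H2) $\Gamma$ is nonempty and closed; - (H3) $g$ is Lipschitz continuous with constant $L_g$; - (H4) there is $D>0$ such that for all $x,y\in X$ there are $T\in[0,D\,\mathbf d(x,y)]$ and a Lipschitz continuous curve $\gamma:[0,T]\to X$ with $\gamma(0)=x$, $\gamma(T)=y$ and $|\dot\gamma|(t)=1$ for almost every $t\in[0,T]$; - (H8) $K$ is continuous and there are constants $K_{\min},K_{\max}>0$ with $K_{\min}\le K(\mu,x)\le K_{\max}$ for all $(\mu,x)\in\mathcal P(X)\times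 X$; - (H9) for every $R>0$ there is $L_R>0$ such that $|K(\mu,x_1)-K(\mu,x_2)|\le L_R\,\mathbf d(x_1,x_2)$ for all $\mu\in\mathcal P(X)$ and $x_1,x_2\in\overline B_X(\mathbf 0,R)$; - (H10) $L_gK_{\max}<1$. For $Q\in\mathcal P(\mathcal C_X)$ put $k_Q(t,x)=K(e_{t\#}Q,x)$, and let $\mathrm{Adm}(k_Q)$ be the set of Lipschitz continuous curves $\gamma:\mathbb R_+\to X$ with $|\dot\gamma|(t)\le k_Q(t,\gamma(t))$ for almost every $t\ge 0$. For $t_0\in\mathbb R_+$ and $\gamma\in\mathcal C_X$ let $\tau(t_0,\gamma)=\inf\{t\ge 0\mid\gamma(t_0+t)\in\Gamma\}\in[0,+\infty]$ (with $\inf\emptyset=+\infty$), and let $G(t_0,\gamma)=g(\gamma(t_0+\tau(t_0,\gamma)))$ if $\tau(t_0,\gamma)<+\infty$ and $G(t_0,\gamma)=+\infty$ otherwise. Define the value function by $$\varphi_Q(t_0,x_0)=\inf\{\tau(t_0,\gamma)+G(t_0,\gamma)\mid \gamma\in\mathrm{Adm}(k_Q),\ \gamma(t_0)=x_0\}\in[0,+\infty].$$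 Then $\varphi_Q(t,x)$ is finite for all $(t,x,Q)$, and the map $(t,x,Q)\mapsto\varphi_Q(t,x)$ is continuous on $\mathbb R_+\times X\times\mathcal P(\mathcal C_X)$. -/

import Mathlib

open Set Filter Topology MeasureTheory
open scoped NNReal ENNReal

namespace MFGExit

/-- `v` is the metric derivative of the curve `c` at the time `t`: the limit of
`dist (c s) (c t) / |s - t|` as `s → t`, `s ≠ t`, exists and equals `v`. -/
def HasMetricDerivAt {X : Type*} [PseudoMetricSpace X] (c : ℝ → X) (v t : ℝ) : Prop :=
  Tendsto (fun s : ℝ => dist (c s) (c t) / |s - t|) (𝓝[≠] t) (𝓝 v)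

/-- `Adm(k)`: the Lipschitz continuous curves `γ : ℝ₊ → X` whose metric derivative (exists and)
is at most `k(t, γ(t))` for almost every `t > 0`.  The curve is read as a function on the real
line through `Real.toNNReal`; near a time `t > 0` this changes nothing. -/
def Adm {X : Type*} [PseudoMetricSpace X] (k : ℝ≥0 → X → ℝ≥0) : Set C(ℝ≥0, X) :=
  {γ | (∃ C : ℝ≥0, LipschitzWith C γ) ∧
    ∀ᵐ t : ℝ ∂(volume.restrict (Ioi 0)),
      ∃ v : ℝ, HasMetricDerivAt (fun s : ℝ => γ s.toNNReal) v t ∧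
        v ≤ k t.toNNReal (γ t.toNNReal)}

/-- First exit time after `t₀`: `τ(t₀, γ) = inf {t ≥ 0 | γ(t₀ + t) ∈ Γ}`, with `inf ∅ = ∞`. -/
noncomputable def exitTime {X : Type*} [TopologicalSpace X] (Γ : Set X) (t₀ : ℝ≥0)
    (γ : C(ℝ≥0, X)) : ℝ≥0∞ :=
  ⨅ (t : ℝ≥0) (_ : γ (t₀ + t) ∈ Γ), (t : ℝ≥0∞)

/-- For a closed target, a finite exit time is attained. -/
theorem mem_of_exitTime_ne_top {X : Type*} [TopologicalSpace X] {Γ : Set X} (hΓ : IsClosed Γ)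
    {t₀ : ℝ≥0} {γ : C(ℝ≥0, X)} (h : exitTime Γ t₀ γ ≠ ∞) :
    γ (t₀ + (exitTime Γ t₀ γ).toNNReal) ∈ Γ := by
  set S : Set ℝ≥0 := {t | γ (t₀ + t) ∈ Γ} with hS
  have hne : S.Nonempty := by
    by_contra hempty
    rw [Set.not_nonempty_iff_eq_empty] at hempty
    apply h
    simp only [exitTime, iInf_eq_top]
    intro t ht
    have : t ∈ S := ht
    simp [hempty] at this
  have hcl : IsClosed S := hΓ.preimage (by fun_prop : Continuous fun t : ℝ≥0 => γ (t₀ + t))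
  have hmem : sInf S ∈ S := hcl.csInf_mem hne (OrderBot.bddBelow S)
  have heq : exitTime Γ t₀ γ = ((sInf S : ℝ≥0) : ℝ≥0∞) := by
    apply le_antisymm
    · exact iInf₂_le (sInf S) hmem
    · refine le_iInf₂ fun t ht => ?_
      exact_mod_cast csInf_le (OrderBot.bddBelow S) ht
  rw [heq, ENNReal.toNNReal_coe]
  exact hmem

open Classical in
/-- Final cost `G(t₀, γ)`: the value of `g` at the exit position `γ(t₀ + τ(t₀, γ))` if
`τ(t₀, γ) < ∞`, and `∞` otherwise.  The membership that is needed to evaluate `g : Γ → ℝ₊` is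
automatic when `Γ` is closed, see `finalCost_of_ne_top`. -/
noncomputable def finalCost {X : Type*} [TopologicalSpace X] (Γ : Set X) (g : Γ → ℝ≥0)
    (t₀ : ℝ≥0) (γ : C(ℝ≥0, X)) : ℝ≥0∞ :=
  if h : exitTime Γ t₀ γ ≠ ∞ ∧ γ (t₀ + (exitTime Γ t₀ γ).toNNReal) ∈ Γ then
    (g ⟨γ (t₀ + (exitTime Γ t₀ γ).toNNReal), h.2⟩ : ℝ≥0∞)
  else ∞

theorem finalCost_of_ne_top {X : Type*} [TopologicalSpace X] {Γ : Set X} (hΓ : IsClosed Γ)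
    (g : Γ → ℝ≥0) {t₀ : ℝ≥0} {γ : C(ℝ≥0, X)} (h : exitTime Γ t₀ γ ≠ ∞) :
    finalCost Γ g t₀ γ =
      (g ⟨γ (t₀ + (exitTime Γ t₀ γ).toNNReal), mem_of_exitTime_ne_top hΓ h⟩ : ℝ≥0∞) :=
  dif_pos ⟨h, mem_of_exitTime_ne_top hΓ h⟩

/-- Value function of the optimal control problem with maximal speed `k`, target `Γ` and exit
cost `g`: the infimum of `τ(t₀, γ) + G(t₀, γ)` over the `k`-admissible curves `γ` with
`γ(t₀) = x₀`. -/
noncomputable def valueFunction {X : Type*} [PseudoMetricSpace X] (Γ : Set X) (g : Γ → ℝ≥0)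
    (k : ℝ≥0 → X → ℝ≥0) (t₀ : ℝ≥0) (x₀ : X) : ℝ≥0∞ :=
  ⨅ (γ : C(ℝ≥0, X)) (_ : γ ∈ Adm k) (_ : γ t₀ = x₀),
    (exitTime Γ t₀ γ + finalCost Γ g t₀ γ)

/-- The distribution of agents `m_t = e_t # Q` at time `t`, where `e_t(γ) = γ(t)`. -/
noncomputable def marginal {X : Type*} [MetricSpace X] [MeasurableSpace X] [BorelSpace X]
    [MeasurableSpace C(ℝ≥0, X)] [BorelSpace C(ℝ≥0, X)]
    (Q : ProbabilityMeasure C(ℝ≥0, X)) (t : ℝ≥0) : ProbabilityMeasure X :=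
  Q.map (f := fun γ : C(ℝ≥0, X) => γ t) (continuous_eval_const t).aemeasurable

/-- `φ_Q`: the value function of the optimal control problem with `k_Q(t, x) = K(e_t # Q, x)`. -/
noncomputable def inducedValue {X : Type*} [MetricSpace X] [MeasurableSpace X] [BorelSpace X]
    [MeasurableSpace C(ℝ≥0, X)] [BorelSpace C(ℝ≥0, X)]
    (Γ : Set X) (g : Γ → ℝ≥0) (K : ProbabilityMeasure X → X → ℝ≥0)
    (Q : ProbabilityMeasure C(ℝ≥0, X)) (t : ℝ≥0) (x : X) : ℝ≥0∞ :=
  valueFunction Γ g (fun s y => K (marginal Q s) y) t x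

end MFGExit

/-!
For a fixed distribution `Q` the maximal speed is `k_Q(t, x) = K(e_t # Q, x)`.  It is jointly
continuous in `(t, x, Q)` because `e_t # Q` is the image of `δ_t ⊗ Q` under the evaluation map
(`continuous_marginal`), so `k_Q` is uniformly close to `k_{Q₀}` on compact sets when `Q` is close
to `Q₀`.  It remains to compare the values of two problems with nearby speeds `k₁`, `k₂` and nearby
starting points (`valueFunction_le_add`).

An admissible curve for `k₁` moves by at most `∫ k₁(u, γ(u)) du`
(`dist_le_integral_of_mem_Adm`).  Taking this integral as a parameter writes it as `σ ∘ ℓ` with `σ`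
a `1`-Lipschitz curve and `ℓ' = k₁(t, σ(ℓ))`
(`exists_reparametrization`).  Since the speeds are locally Lipschitz in space, with a constant `L`,
the delayed position `m(t) = ℓ(t) - η e^{(L+1)t}` satisfies `m' ≤ k₂(t, σ(m))` as soon as
`k₁ ≤ k₂ + η`: an explicit subsolution takes the place of solving an ordinary differential equation
and of Gronwall's lemma.  Following `σ` at the position `m` is then admissible for `k₂`
(`exists_mem_Adm_of_position`); the existence of its metric derivative is a Rademacher theorem for
curves (`ae_exists_hasMetricDerivAt`).  The new curve waits at its starting point until `m` has
become large enough, travels to the starting point of the first one, and reaches `Γ` at the same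
point as the first one, later by `O(η)`.

The new curve may also cross `Γ` on its way between the two starting points.  This is harmless:
because `Lg * Kmax < 1`, leaving at the first crossing is no more expensive than leaving at a later
one (`valueFunction_le_of_mem`).
-/

namespace MFGExit

/-! ### Metric derivatives and admissible curves -/

theorem HasMetricDerivAt.abs_deriv_dist_le {X : Type*} [PseudoMetricSpace X] {c : ℝ → X} {v t : ℝ}
    (h : HasMetricDerivAt c v t) {p : X} {w : ℝ} (hw : HasDerivAt (fun s => dist (c s) p) w t) :
    |w| ≤ v := by
  have h1 := hw.tendsto_slope.abs
  refine le_of_tendsto_of_tendsto h1 h ?_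
  filter_upwards [self_mem_nhdsWithin] with s hs
  rw [slope_def_field, abs_div]
  gcongr
  exact abs_dist_sub_le _ _ _

theorem lipschitzOnWith_dist_right {X : Type*} [PseudoMetricSpace X] {c : ℝ → X} {C : ℝ≥0}
    {s : Set ℝ} (hc : LipschitzOnWith C c s) (p : X) :
    LipschitzOnWith C (fun u => dist (c u) p) s := by
  simpa [Function.comp_def] using (LipschitzWith.dist_left p).comp_lipschitzOnWith hc

/-- A Lipschitz curve travels no further than the integral of an upper bound of its speed. -/
theorem dist_le_integral_of_metricDeriv_le {X : Type*} [PseudoMetricSpace X] {c : ℝ → X}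
    {C : ℝ≥0} {a b : ℝ} (hab : a ≤ b) (hc : LipschitzOnWith C c (Icc a b)) {κ : ℝ → ℝ}
    (hκ : IntervalIntegrable κ volume a b)
    (h : ∀ᵐ t ∂(volume.restrict (Ioo a b)), ∃ v, HasMetricDerivAt c v t ∧ v ≤ κ t) :
    dist (c a) (c b) ≤ ∫ t in a..b, κ t := by
  have hac : AbsolutelyContinuousOnInterval (fun u => dist (c u) (c a)) a b :=
    LipschitzOnWith.absolutelyContinuousOnInterval (K := C) (by
      rw [uIcc_of_le hab]; exact lipschitzOnWith_dist_right hc _)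
  have hftc := hac.integral_deriv_eq_sub
  rw [dist_self, sub_zero, dist_comm] at hftc
  rw [← hftc]
  refine intervalIntegral.integral_mono_ae_restrict hab hac.intervalIntegrable_deriv hκ ?_
  rw [EventuallyLE, ← restrict_Ioo_eq_restrict_Icc]
  have hd := hac.ae_differentiableAt
  rw [uIcc_of_le hab] at hd
  filter_upwards [h, ae_restrict_of_ae hd, ae_restrict_mem measurableSet_Ioo] with t ht hdt htm
  obtain ⟨v, hv, hvk⟩ := ht
  exact ((le_abs_self _).trans
    (hv.abs_deriv_dist_le (hdt (Ioo_subset_Icc_self htm)).hasDerivAt)).trans hvk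

/-- A Lipschitz curve in a separable space has a metric derivative almost everywhere.  The
derivative is the supremum `m` of the derivatives of the distances to a dense sequence: `m` bounds
the difference quotients from above at its Lebesgue points, and from below because each distance
function is a contraction. -/
theorem ae_exists_hasMetricDerivAt {X : Type*} [PseudoMetricSpace X]
    [TopologicalSpace.SeparableSpace X] {c : ℝ → X} {C : ℝ≥0} (hc : LipschitzWith C c) :
    ∀ᵐ t : ℝ, ∃ v, HasMetricDerivAt c v t := by
  have : Nonempty X := ⟨c 0⟩
  set p := TopologicalSpace.denseSeq X
  have hp : DenseRange p := TopologicalSpace.denseRange_denseSeq X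
  set f : ℕ → ℝ → ℝ := fun n t => dist (c t) (p n) with hf
  have hfl : ∀ n, LipschitzWith C (f n) := fun n => by
    simpa [Function.comp_def, hf] using (LipschitzWith.dist_left (p n)).comp hc
  have hbd : ∀ n t, |deriv (f n) t| ≤ C := fun n t => norm_deriv_le_of_lipschitz (hfl n)
  set m : ℝ → ℝ := fun t => ⨆ n, |deriv (f n) t| with hm
  have hbdd : ∀ t, BddAbove (range fun n => |deriv (f n) t|) := fun t =>
    ⟨C, by rintro _ ⟨n, rfl⟩; exact hbd n t⟩
  have hle : ∀ n t, |deriv (f n) t| ≤ m t := fun n t => le_ciSup (hbdd t) n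
  have hm0 : ∀ t, 0 ≤ m t := fun t => (abs_nonneg _).trans (hle 0 t)
  have hmC : ∀ t, m t ≤ C := fun t => ciSup_le fun n => hbd n t
  have hmeas : Measurable m := Measurable.iSup fun n => (measurable_deriv (f n)).abs
  have hloc : LocallyIntegrable m volume := by
    refine (locallyIntegrable_const (C : ℝ)).mono hmeas.aestronglyMeasurable
      (Eventually.of_forall fun t => ?_)
    rw [Real.norm_of_nonneg (hm0 t), Real.norm_of_nonneg C.coe_nonneg]
    exact hmC t
  have hint : ∀ a b, IntervalIntegrable m volume a b := fun a b =>
    (hloc.integrableOn_isCompact isCompact_uIcc).intervalIntegrable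
  have hdist : ∀ a b, a ≤ b → dist (c a) (c b) ≤ ∫ t in a..b, m t := by
    intro a b hab
    refine le_of_forall_pos_le_add fun ε hε => ?_
    obtain ⟨n, hn⟩ := hp.exists_dist_lt (c a) (half_pos hε)
    have hac : AbsolutelyContinuousOnInterval (f n) a b :=
      LipschitzOnWith.absolutelyContinuousOnInterval (K := C) (hfl n).lipschitzOnWith
    have h1 : f n b - f n a ≤ ∫ t in a..b, m t := by
      rw [← hac.integral_deriv_eq_sub]
      exact intervalIntegral.integral_mono_on hab hac.intervalIntegrable_deriv (hint a b)
        fun t _ => (le_abs_self _).trans (hle n t)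
    have h2 := dist_triangle_right (c a) (c b) (p n)
    simp only [hf] at h1
    linarith
  filter_upwards [LocallyIntegrable.ae_hasDerivAt_integral hloc,
    ae_all_iff.2 fun n => (hfl n).ae_differentiableAt_real] with t ht hd
  have habs : ∀ s, dist (c s) (c t) ≤ |∫ u in t..s, m u| := by
    intro s
    rcases le_total t s with h | h
    · rw [dist_comm]
      exact (hdist t s h).trans (le_abs_self _)
    · rw [intervalIntegral.integral_symm, abs_neg]
      exact (hdist s t h).trans (le_abs_self _)
  refine ⟨m t, ?_⟩
  have hup : Tendsto (fun s => |∫ u in t..s, m u| / |s - t|) (𝓝[≠] t) (𝓝 (m t)) := by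
    have := (ht t).tendsto_slope.abs
    rw [abs_of_nonneg (hm0 t)] at this
    refine this.congr fun s => ?_
    rw [slope_def_field, abs_div, intervalIntegral.integral_same, sub_zero]
  rw [HasMetricDerivAt, tendsto_order]
  constructor
  · intro w hw
    obtain ⟨n, hn⟩ := exists_lt_of_lt_ciSup hw
    have := (hd n).hasDerivAt.tendsto_slope.abs
    filter_upwards [this.eventually (lt_mem_nhds hn)] with s hs
    refine hs.trans_le ?_
    rw [slope_def_field, abs_div]
    gcongr
    exact abs_dist_sub_le _ _ _
  · intro w hw
    filter_upwards [hup.eventually (gt_mem_nhds hw)] with s hs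
    refine lt_of_le_of_lt ?_ hs
    gcongr
    exact habs s

theorem lipschitzWith_comp_toNNReal {X : Type*} [PseudoMetricSpace X] {γ : ℝ≥0 → X} {C : ℝ≥0}
    (hγ : LipschitzWith C γ) : LipschitzWith C fun s : ℝ => γ s.toNNReal := by
  simpa [Function.comp_def] using hγ.comp Real.lipschitzWith_toNNReal

/-- A Lipschitz curve is admissible as soon as, at every time `t > 0`, its displacement to the
right of `t` is dominated by the increment of a function with right derivative at most
`k(t, γ(t))`. -/
theorem mem_Adm_of_forall_right_bound {X : Type*} [PseudoMetricSpace X]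
    [TopologicalSpace.SeparableSpace X] {k : ℝ≥0 → X → ℝ≥0} {γ : C(ℝ≥0, X)} {C : ℝ≥0}
    (hγ : LipschitzWith C γ)
    (h : ∀ t : ℝ, 0 < t → ∃ (F : ℝ → ℝ) (w : ℝ), HasDerivWithinAt F w (Ioi t) t ∧
      (∀ᶠ s in 𝓝[>] t, dist (γ s.toNNReal) (γ t.toNNReal) ≤ F s - F t) ∧
      w ≤ k t.toNNReal (γ t.toNNReal)) : γ ∈ Adm k := by
  refine ⟨⟨C, hγ⟩, ?_⟩
  filter_upwards [ae_restrict_of_ae (ae_exists_hasMetricDerivAt (lipschitzWith_comp_toNNReal hγ)),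
    ae_restrict_mem measurableSet_Ioi] with t ht ht0
  obtain ⟨v, hv⟩ := ht
  obtain ⟨F, w, hF, hle, hw⟩ := h t ht0
  refine ⟨v, hv, le_trans ?_ hw⟩
  have h1 := hv.mono_left (nhdsWithin_mono t fun s (hs : s ∈ Ioi t) => ne_of_gt hs)
  have h2 := (hasDerivWithinAt_iff_tendsto_slope' self_notMem_Ioi).1 hF
  refine le_of_tendsto_of_tendsto (b := 𝓝[>] t) h1 h2 ?_
  filter_upwards [hle, self_mem_nhdsWithin] with s hs hst
  have hst' : 0 < s - t := sub_pos.2 hst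
  rw [slope_def_field, abs_of_pos hst']
  gcongr

/-- An admissible curve travels no further than the integral of the maximal speed along it. -/
theorem dist_le_integral_of_mem_Adm {X : Type*} [PseudoMetricSpace X] {k : ℝ≥0 → X → ℝ≥0}
    (hk : Continuous fun p : ℝ≥0 × X => k p.1 p.2) {γ : C(ℝ≥0, X)} (hγ : γ ∈ Adm k) {a b : ℝ}
    (ha : 0 ≤ a) (hab : a ≤ b) :
    dist (γ a.toNNReal) (γ b.toNNReal) ≤ ∫ t in a..b, (k t.toNNReal (γ t.toNNReal) : ℝ) := by
  obtain ⟨⟨C, hC⟩, h⟩ := hγ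
  have hcont : Continuous fun t : ℝ => (k t.toNNReal (γ t.toNNReal) : ℝ) :=
    NNReal.continuous_coe.comp (hk.comp (by fun_prop :
      Continuous fun t : ℝ => (t.toNNReal, γ t.toNNReal)))
  refine dist_le_integral_of_metricDeriv_le (c := fun s : ℝ => γ s.toNNReal) hab
    (lipschitzWith_comp_toNNReal hC).lipschitzOnWith (hcont.intervalIntegrable a b) ?_
  exact ae_restrict_of_ae_restrict_of_subset (fun t ht => lt_of_le_of_lt ha ht.1) h

theorem dist_le_sub_of_metricDeriv_eq_one {X : Type*} [PseudoMetricSpace X] {c : ℝ → X} {C : ℝ≥0}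
    {T : ℝ} (hc : LipschitzOnWith C c (Icc 0 T))
    (h : ∀ᵐ t ∂(volume.restrict (Ioo 0 T)), HasMetricDerivAt c 1 t) {s t : ℝ} (hs : 0 ≤ s)
    (hst : s ≤ t) (ht : t ≤ T) : dist (c s) (c t) ≤ t - s := by
  have := dist_le_integral_of_metricDeriv_le (κ := fun _ => 1) hst
    (hc.mono (Icc_subset_Icc hs ht)) (intervalIntegrable_const) ?_
  · simpa using this
  · filter_upwards [ae_restrict_of_ae_restrict_of_subset (Ioo_subset_Ioo hs ht) h] with u hu
    exact ⟨1, hu, le_rfl⟩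

/-! ### Continuity of the marginals -/

/-- Weak convergence of the laws `Q` and convergence of the times `t` give weak convergence of
`e_t # Q`, which is the image of `δ_t ⊗ Q` under `(t, γ) ↦ γ(t)`. -/
theorem continuous_marginal {X : Type*} [MetricSpace X] [SecondCountableTopology X]
    [MeasurableSpace X] [BorelSpace X] [MeasurableSpace C(ℝ≥0, X)] [BorelSpace C(ℝ≥0, X)] :
    Continuous fun p : ℝ≥0 × ProbabilityMeasure C(ℝ≥0, X) => marginal p.2 p.1 := by
  have hev : Continuous fun q : ℝ≥0 × C(ℝ≥0, X) => q.2 q.1 := by fun_prop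
  have h : (fun p : ℝ≥0 × ProbabilityMeasure C(ℝ≥0, X) => marginal p.2 p.1) = fun p =>
      ((diracProba p.1).prod p.2).map hev.measurable.aemeasurable := by
    ext p : 1
    apply Subtype.ext
    simp only [marginal, ProbabilityMeasure.map]
    change _ = Measure.map _ ((Measure.dirac p.1).prod (p.2 : Measure C(ℝ≥0, X)))
    rw [Measure.dirac_prod, Measure.map_map hev.measurable (by fun_prop)]
    rfl
  rw [h]
  refine (ProbabilityMeasure.continuous_map hev).comp (ProbabilityMeasure.continuous_prod.comp
    (g := fun μ => μ.1.prod μ.2)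
    (f := fun p : ℝ≥0 × ProbabilityMeasure C(ℝ≥0, X) => (diracProba p.1, p.2)) ?_)
  exact (continuous_diracProba.comp continuous_fst).prodMk continuous_snd

/-! ### Bounds for the value function -/

theorem dist_le_mul_sub_of_mem_Adm {X : Type*} [PseudoMetricSpace X] {k : ℝ≥0 → X → ℝ≥0}
    (hk : Continuous fun p : ℝ≥0 × X => k p.1 p.2) {Kmax : ℝ≥0} (hmax : ∀ t x, k t x ≤ Kmax)
    {γ : C(ℝ≥0, X)} (hγ : γ ∈ Adm k) {a b : ℝ≥0} (hab : a ≤ b) :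
    dist (γ a) (γ b) ≤ Kmax * ((b : ℝ) - a) := by
  have h := dist_le_integral_of_mem_Adm hk hγ a.coe_nonneg (NNReal.coe_le_coe.2 hab)
  simp only [Real.toNNReal_coe] at h
  have hcont : Continuous fun t : ℝ => (k t.toNNReal (γ t.toNNReal) : ℝ) :=
    NNReal.continuous_coe.comp (hk.comp (by fun_prop :
      Continuous fun t : ℝ => (t.toNNReal, γ t.toNNReal)))
  refine h.trans ?_
  calc ∫ t in (a : ℝ)..b, (k t.toNNReal (γ t.toNNReal) : ℝ)
      ≤ ∫ _ in (a : ℝ)..b, (Kmax : ℝ) :=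
        intervalIntegral.integral_mono_on (NNReal.coe_le_coe.2 hab) (hcont.intervalIntegrable _ _)
          intervalIntegrable_const fun t _ => NNReal.coe_le_coe.2 (hmax _ _)
    _ = Kmax * ((b : ℝ) - a) := by simp [mul_comm]

/-- Stopping an admissible curve at any time of presence in `Γ`, not only the first one, costs at
least the value function: waiting from the first exit for a time `s` moves the curve by at most
`Kmax * s`, hence lowers the exit cost by at most `Lg * Kmax * s ≤ s`. -/
theorem valueFunction_le_of_mem {X : Type*} [PseudoMetricSpace X] {Γ : Set X} (hΓ : IsClosed Γ)
    {g : Γ → ℝ≥0} {Lg : ℝ≥0} (hg : LipschitzWith Lg g) {k : ℝ≥0 → X → ℝ≥0}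
    (hk : Continuous fun p : ℝ≥0 × X => k p.1 p.2) {Kmax : ℝ≥0} (hmax : ∀ t x, k t x ≤ Kmax)
    (hLgK : Lg * Kmax ≤ 1) {γ : C(ℝ≥0, X)} (hγ : γ ∈ Adm k) {t₀ h : ℝ≥0} (hh : γ (t₀ + h) ∈ Γ) :
    valueFunction Γ g k t₀ (γ t₀) ≤ h + g ⟨γ (t₀ + h), hh⟩ := by
  have hτ : exitTime Γ t₀ γ ≤ h := iInf₂_le h hh
  have hne : exitTime Γ t₀ γ ≠ ∞ := ne_top_of_le_ne_top ENNReal.coe_ne_top hτ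
  refine (iInf₂_le_of_le γ hγ (iInf_le_of_le rfl le_rfl)).trans ?_
  rw [finalCost_of_ne_top hΓ g hne]
  have hmem := mem_of_exitTime_ne_top hΓ hne
  have key : ∀ (τ : ℝ≥0) (hτ : γ (t₀ + τ) ∈ Γ), τ ≤ h →
      (τ : ℝ≥0∞) + g ⟨γ (t₀ + τ), hτ⟩ ≤ h + g ⟨γ (t₀ + h), hh⟩ := by
    intro τ hmem hτh
    norm_cast
    have h1 : (g ⟨γ (t₀ + τ), hmem⟩ : ℝ) - g ⟨γ (t₀ + h), hh⟩ ≤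
        Lg * dist (γ (t₀ + τ)) (γ (t₀ + h)) :=
      (le_abs_self _).trans (hg.dist_le_mul ⟨γ (t₀ + τ), hmem⟩ ⟨γ (t₀ + h), hh⟩)
    have h2 := dist_le_mul_sub_of_mem_Adm hk hmax hγ (add_le_add_right hτh t₀)
    have h3 : (Lg : ℝ) * dist (γ (t₀ + τ)) (γ (t₀ + h)) ≤ h - τ := by
      have h4 : (Lg : ℝ) * Kmax ≤ 1 := by exact_mod_cast hLgK
      have h5 : (0 : ℝ) ≤ h - τ := sub_nonneg.2 (NNReal.coe_le_coe.2 hτh)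
      push_cast at h2
      calc (Lg : ℝ) * dist (γ (t₀ + τ)) (γ (t₀ + h)) ≤ Lg * (Kmax * (h - τ)) := by
            gcongr
            linarith
        _ = Lg * Kmax * (h - τ) := by ring
        _ ≤ 1 * (h - τ) := by gcongr
        _ = h - τ := one_mul _
    rw [← NNReal.coe_le_coe]
    push_cast
    linarith
  have := key _ hmem (by simpa using ENNReal.toNNReal_mono ENNReal.coe_ne_top hτ)
  rwa [ENNReal.coe_toNNReal hne] at this

theorem exists_of_valueFunction_lt {X : Type*} [PseudoMetricSpace X] {Γ : Set X}
    (hΓ : IsClosed Γ) {g : Γ → ℝ≥0} {k : ℝ≥0 → X → ℝ≥0} {t₀ : ℝ≥0} {x₀ : X} {a : ℝ≥0∞}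
    (ha : valueFunction Γ g k t₀ x₀ < a) :
    ∃ γ ∈ Adm k, γ t₀ = x₀ ∧ ∃ (h : ℝ≥0) (hh : γ (t₀ + h) ∈ Γ),
      (h : ℝ≥0∞) + g ⟨γ (t₀ + h), hh⟩ < a := by
  simp only [valueFunction, iInf_lt_iff] at ha
  obtain ⟨γ, hγ, hx, hlt⟩ := ha
  have hne : exitTime Γ t₀ γ ≠ ∞ := fun h => by simp [h] at hlt
  refine ⟨γ, hγ, hx, (exitTime Γ t₀ γ).toNNReal, mem_of_exitTime_ne_top hΓ hne, ?_⟩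
  rw [finalCost_of_ne_top hΓ g hne] at hlt
  rwa [ENNReal.coe_toNNReal hne]

/-- The value function is bounded by the cost of running at the constant speed `Kmin` along a curve
of length at most `b` to a given point of `Γ`. -/
theorem valueFunction_le_of_curve {X : Type*} [PseudoMetricSpace X]
    [TopologicalSpace.SeparableSpace X] {Γ : Set X} (hΓ : IsClosed Γ)
    {g : Γ → ℝ≥0} {Lg : ℝ≥0} (hg : LipschitzWith Lg g) {k : ℝ≥0 → X → ℝ≥0}
    (hk : Continuous fun p : ℝ≥0 × X => k p.1 p.2) {Kmin Kmax : ℝ≥0} (hKmin : 0 < Kmin)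
    (hmin : ∀ t x, Kmin ≤ k t x) (hmax : ∀ t x, k t x ≤ Kmax) (hLgK : Lg * Kmax ≤ 1)
    (t₀ : ℝ≥0) {x p : X} (hp : p ∈ Γ) {b : ℝ} (hb : 0 ≤ b) {c : ℝ → X} (hc0 : c 0 = x)
    (hcb : c b = p) (hc : ∀ s t, 0 ≤ s → s ≤ t → t ≤ b → dist (c s) (c t) ≤ t - s) :
    valueFunction Γ g k t₀ x ≤ ENNReal.ofReal (b / Kmin) + g ⟨p, hp⟩ := by
  have hKmin' : (0 : ℝ) < Kmin := hKmin
  set γ₀ : ℝ≥0 → X := fun t => c (max 0 (min b (Kmin * ((t : ℝ) - t₀)))) with hγ₀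
  have hdist : ∀ s t : ℝ≥0, s ≤ t → dist (γ₀ s) (γ₀ t) ≤ Kmin * ((t : ℝ) - s) := by
    intro s t hst
    have hst' : (s : ℝ) ≤ t := hst
    have hle : (Kmin : ℝ) * (s - t₀) ≤ Kmin * (t - t₀) := by gcongr
    refine (hc _ _ (le_max_left _ _) (max_le_max le_rfl (min_le_min le_rfl hle))
      (max_le hb (min_le_left _ _))).trans ?_
    have h1 : (Kmin : ℝ) * (t - t₀) = Kmin * (s - t₀) + Kmin * (t - s) := by ring
    have h2 : (0 : ℝ) ≤ Kmin * (t - s) := mul_nonneg hKmin'.le (sub_nonneg.2 hst')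
    grind
  have hlip : LipschitzWith Kmin γ₀ := by
    refine LipschitzWith.of_dist_le_mul fun s t => ?_
    rw [NNReal.dist_eq]
    rcases le_total s t with h | h
    · rw [abs_sub_comm, abs_of_nonneg (sub_nonneg.2 (NNReal.coe_le_coe.2 h))]
      exact hdist s t h
    · rw [dist_comm, abs_of_nonneg (sub_nonneg.2 (NNReal.coe_le_coe.2 h))]
      exact hdist t s h
  set γ : C(ℝ≥0, X) := ⟨γ₀, hlip.continuous⟩
  have hγ : γ ∈ Adm k := by
    refine mem_Adm_of_forall_right_bound hlip fun t ht => ⟨fun s => Kmin * s, Kmin, ?_, ?_, ?_⟩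
    · simpa using ((hasDerivAt_id t).const_mul (Kmin : ℝ)).hasDerivWithinAt
    · filter_upwards [self_mem_nhdsWithin] with s (hs : t < s)
      rw [dist_comm]
      refine (hdist _ _ (Real.toNNReal_le_toNNReal hs.le)).trans ?_
      rw [Real.coe_toNNReal _ ht.le, Real.coe_toNNReal _ (ht.trans hs).le]
      simp only [mul_sub, le_refl]
    · exact NNReal.coe_le_coe.2 (hmin _ _)
  set h : ℝ≥0 := Real.toNNReal (b / Kmin) with hh
  have hhc : (h : ℝ) = b / Kmin := Real.coe_toNNReal _ (by positivity)
  have hend : γ (t₀ + h) = p := by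
    change c _ = p
    rw [← hcb]
    congr 1
    push_cast
    rw [hhc, add_sub_cancel_left, mul_div_cancel₀ _ hKmin'.ne', min_self, max_eq_right hb]
  have hstart : γ t₀ = x := by
    change c _ = x
    rw [← hc0]
    simp [hb]
  have hmem : γ (t₀ + h) ∈ Γ := hend ▸ hp
  have := valueFunction_le_of_mem hΓ hg hk hmax hLgK hγ hmem
  rw [hstart] at this
  rw [ENNReal.ofReal, ← hh]
  simpa only [hend] using this

/-! ### Change of parameter -/

/-- An admissible curve `γ`, seen from time `t₁` on, is a `1`-Lipschitz curve `σ` run with position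
`ℓ(t) = ∫ k(u, γ(u)) du` on it.  On the parameters `[-b, 0]` the curve `σ` is a given curve that
leads to `γ(t₁)`, and `ℓ` is continued to `t < t₁` with constant speed. -/
theorem exists_reparametrization {X : Type*} [PseudoMetricSpace X] {k : ℝ≥0 → X → ℝ≥0}
    (hk : Continuous fun p : ℝ≥0 × X => k p.1 p.2) {Kmin : ℝ≥0} (hKmin : 0 < Kmin)
    (hmin : ∀ t x, Kmin ≤ k t x) {γ : C(ℝ≥0, X)} (hγ : γ ∈ Adm k) (t₁ : ℝ≥0) {b : ℝ}
    (hb : 0 ≤ b) {c : ℝ → X} (hcb : c b = γ t₁)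
    (hc : ∀ s t, 0 ≤ s → s ≤ t → t ≤ b → dist (c s) (c t) ≤ t - s) :
    ∃ (σ : ℝ → X) (ℓ : ℝ → ℝ), LipschitzWith 1 σ ∧ σ (-b) = c 0 ∧ ℓ t₁ = 0 ∧
      (∀ t : ℝ, HasDerivAt ℓ (k (max t (t₁ : ℝ)).toNNReal (γ (max t (t₁ : ℝ)).toNNReal)) t) ∧
      ∀ t : ℝ≥0, t₁ ≤ t → σ (ℓ t) = γ t := by
  have hKmin' : (0 : ℝ) < Kmin := hKmin
  set κ : ℝ → ℝ := fun t => k (max t t₁).toNNReal (γ (max t t₁).toNNReal) with hκ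
  have hcont : Continuous κ := NNReal.continuous_coe.comp (hk.comp (by fun_prop :
      Continuous fun t : ℝ => ((max t t₁).toNNReal, γ (max t t₁).toNNReal)))
  set ℓ : ℝ → ℝ := fun t => ∫ u in (t₁ : ℝ)..t, κ u with hℓ
  have hder : ∀ t, HasDerivAt ℓ (κ t) t := fun t => hcont.integral_hasStrictDerivAt _ t |>.hasDerivAt
  have hinc : ∀ s t, s ≤ t → Kmin * (t - s) ≤ ℓ t - ℓ s := fun s t hst =>
    mul_sub_le_image_sub_of_le_deriv (fun u => (hder u).differentiableAt)
      (fun u => by rw [(hder u).deriv]; exact NNReal.coe_le_coe.2 (hmin _ _)) hst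
  have hmono : StrictMono ℓ := fun s t hst => by
    have := hinc s t hst.le
    have h2 := mul_pos hKmin' (sub_pos.2 hst)
    linarith
  have hℓ0 : ℓ t₁ = 0 := intervalIntegral.integral_same
  have hdist : ∀ s t : ℝ, t₁ ≤ s → s ≤ t → dist (γ s.toNNReal) (γ t.toNNReal) ≤ ℓ t - ℓ s := by
    intro s t hs hst
    refine (dist_le_integral_of_mem_Adm hk hγ (t₁.coe_nonneg.trans hs) hst).trans (le_of_eq ?_)
    rw [hℓ, intervalIntegral.integral_interval_sub_left (hcont.intervalIntegrable _ _)
      (hcont.intervalIntegrable _ _)]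
    refine intervalIntegral.integral_congr fun u hu => ?_
    rw [uIcc_of_le hst] at hu
    simp only [hκ, max_eq_left (hs.trans hu.1)]
  have hsurj : ∀ r : ℝ, ∃ t : ℝ, 0 ≤ r → t₁ ≤ t ∧ ℓ t = r := by
    intro r
    by_cases hr : 0 ≤ r
    · have hle : (t₁ : ℝ) ≤ t₁ + r / Kmin := le_add_of_nonneg_right (by positivity)
      have h1 := hinc _ _ hle
      rw [add_sub_cancel_left, mul_div_cancel₀ _ hKmin'.ne', hℓ0, sub_zero] at h1
      obtain ⟨t, ht, htr⟩ := intermediate_value_Icc hle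
        (fun u _ => (hder u).continuousAt.continuousWithinAt)
        (⟨hℓ0.trans_le hr, h1⟩ : r ∈ Icc (ℓ t₁) (ℓ (t₁ + r / Kmin)))
      exact ⟨t, fun _ => ⟨ht.1, htr⟩⟩
    · exact ⟨0, fun h => absurd h hr⟩
  choose ρ hρ using hsurj
  set σ : ℝ → X := fun r => if r ≤ 0 then c (max (r + b) 0) else γ (ρ r).toNNReal with hσ
  have hσneg : ∀ r, r ≤ 0 → σ r = c (max (r + b) 0) := fun r hr => if_pos hr
  have hσℓ : ∀ t : ℝ, t₁ ≤ t → σ (ℓ t) = γ t.toNNReal := by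
    intro t ht
    rcases ht.eq_or_lt with rfl | hlt
    · rw [hℓ0, hσneg 0 le_rfl, zero_add, max_eq_left hb, hcb, Real.toNNReal_coe]
    · have hpos : 0 < ℓ t := hℓ0 ▸ hmono hlt
      have : ρ (ℓ t) = t := hmono.injective (hρ _ hpos.le).2
      simp only [hσ, if_neg hpos.not_ge, this]
  have hle_neg : ∀ r s, r ≤ s → s ≤ 0 → dist (σ r) (σ s) ≤ s - r := by
    intro r s hrs hs
    rw [hσneg r (hrs.trans hs), hσneg s hs]
    refine (hc _ _ (le_max_right _ _) (max_le_max (by linarith) le_rfl)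
      (max_le (by linarith) hb)).trans ?_
    grind
  have hle_pos : ∀ r s, 0 ≤ r → r ≤ s → dist (σ r) (σ s) ≤ s - r := by
    intro r s hr hrs
    obtain ⟨h1, h2⟩ := hρ r hr
    obtain ⟨h3, h4⟩ := hρ s (hr.trans hrs)
    have h5 : ρ r ≤ ρ s := hmono.le_iff_le.1 (by rw [h2, h4]; exact hrs)
    have := hdist _ _ h1 h5
    rwa [← hσℓ _ h1, ← hσℓ _ h3, h2, h4] at this
  have hle : ∀ r s, r ≤ s → dist (σ r) (σ s) ≤ s - r := by
    intro r s hrs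
    rcases le_total s 0 with hs | hs
    · exact hle_neg r s hrs hs
    rcases le_total 0 r with hr | hr
    · exact hle_pos r s hr hrs
    have := dist_triangle (σ r) (σ 0) (σ s)
    linarith [hle_neg r 0 hr le_rfl, hle_pos 0 s le_rfl hs]
  refine ⟨σ, ℓ, ?_, ?_, hℓ0, hder, ?_⟩
  · refine LipschitzWith.of_dist_le_mul fun r s => ?_
    rw [NNReal.coe_one, one_mul, Real.dist_eq]
    rcases le_total r s with h | h
    · rw [abs_sub_comm, abs_of_nonneg (sub_nonneg.2 h)]
      exact hle r s h
    · rw [dist_comm, abs_of_nonneg (sub_nonneg.2 h)]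
      exact hle s r h
  · rw [hσneg _ (neg_nonpos.2 hb), neg_add_cancel, max_self]
  · intro t ht
    simpa using hσℓ t (NNReal.coe_le_coe.2 ht)

/-- Running along a `1`-Lipschitz curve `σ` with position `max (m t) (-b)` up to time `M`, and
standing still afterwards, is admissible when `m' ≤ k(t, σ(m t))` wherever `m ≥ -b`. -/
theorem exists_mem_Adm_of_position {X : Type*} [PseudoMetricSpace X]
    [TopologicalSpace.SeparableSpace X] {k : ℝ≥0 → X → ℝ≥0} {Kmax : ℝ≥0} {σ : ℝ → X}
    (hσ : LipschitzWith 1 σ) {b M : ℝ} (hM : 0 ≤ M) {m m' : ℝ → ℝ} (hm : ∀ t, HasDerivAt m (m' t) t)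
    (hm0 : ∀ t, 0 ≤ t → t ≤ M → 0 ≤ m' t) (hmK : ∀ t, 0 ≤ t → t ≤ M → m' t ≤ Kmax)
    (hmk : ∀ t, 0 ≤ t → t ≤ M → -b ≤ m t → m' t ≤ k t.toNNReal (σ (m t))) :
    ∃ γ ∈ Adm k, ∀ t : ℝ≥0, γ t = σ (max (m (min t M)) (-b)) := by
  have hbound : ∀ s t, 0 ≤ s → s ≤ t → t ≤ M → m s ≤ m t ∧ m t - m s ≤ Kmax * (t - s) := by
    intro s t hs hst ht
    have hcont : ContinuousOn m (Icc 0 M) := fun u _ => (hm u).continuousAt.continuousWithinAt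
    have hdiff : DifferentiableOn ℝ m (interior (Icc 0 M)) := fun u _ =>
      (hm u).differentiableAt.differentiableWithinAt
    constructor
    · refine monotoneOn_of_deriv_nonneg (convex_Icc 0 M) hcont hdiff (fun u hu => ?_)
        ⟨hs, hst.trans ht⟩ ⟨hs.trans hst, ht⟩ hst
      rw [(hm u).deriv]
      exact hm0 u (interior_subset hu).1 (interior_subset hu).2
    · refine (convex_Icc 0 M).image_sub_le_mul_sub_of_deriv_le hcont hdiff (fun u hu => ?_)
        s ⟨hs, hst.trans ht⟩ t ⟨hs.trans hst, ht⟩ hst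
      rw [(hm u).deriv]
      exact hmK u (interior_subset hu).1 (interior_subset hu).2
  set q : ℝ → ℝ := fun t => max (m (min t M)) (-b) with hq
  have hqb : ∀ s t, 0 ≤ s → s ≤ t → q s ≤ q t ∧ q t - q s ≤ Kmax * (t - s) := by
    intro s t hs hst
    obtain ⟨h1, h2⟩ := hbound (min s M) (min t M) (le_min hs hM) (min_le_min_right M hst)
      (min_le_right _ _)
    have h3 : min t M - min s M ≤ t - s := by grind
    have h4 : (Kmax : ℝ) * (min t M - min s M) ≤ Kmax * (t - s) := by gcongr
    have h5 : (0 : ℝ) ≤ Kmax * (t - s) := mul_nonneg Kmax.coe_nonneg (sub_nonneg.2 hst)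
    refine ⟨max_le_max h1 le_rfl, ?_⟩
    simp only [hq]
    grind
  have hσd : ∀ r s, r ≤ s → dist (σ s) (σ r) ≤ s - r := fun r s hrs => by
    have := hσ.dist_le_mul s r
    rwa [NNReal.coe_one, one_mul, Real.dist_eq, abs_of_nonneg (sub_nonneg.2 hrs)] at this
  have hdist : ∀ s t : ℝ, 0 ≤ s → s ≤ t → dist (σ (q t)) (σ (q s)) ≤ q t - q s :=
    fun s t hs hst => hσd _ _ (hqb s t hs hst).1
  have hlip : LipschitzWith Kmax fun t : ℝ≥0 => σ (q t) := by
    refine LipschitzWith.of_dist_le_mul fun s t => ?_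
    rw [NNReal.dist_eq]
    rcases le_total s t with h | h
    · rw [dist_comm, abs_sub_comm, abs_of_nonneg (sub_nonneg.2 (NNReal.coe_le_coe.2 h))]
      exact (hdist s t s.coe_nonneg h).trans (hqb s t s.coe_nonneg h).2
    · rw [abs_of_nonneg (sub_nonneg.2 (NNReal.coe_le_coe.2 h))]
      exact (hdist t s t.coe_nonneg h).trans (hqb t s t.coe_nonneg h).2
  refine ⟨⟨fun t : ℝ≥0 => σ (q t), hlip.continuous⟩,
    mem_Adm_of_forall_right_bound hlip fun t ht => ?_, fun t => rfl⟩
  have key : ∀ᶠ s in 𝓝[>] t, dist (σ (q s.toNNReal)) (σ (q t.toNNReal)) ≤ q s - q t := by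
    filter_upwards [self_mem_nhdsWithin] with s (hs : t < s)
    rw [Real.coe_toNNReal _ ht.le, Real.coe_toNNReal _ (ht.trans hs).le]
    exact hdist t s ht.le hs.le
  -- To the right of `t` the position is `m` or constant, according to the phase reached at `t`.
  by_cases hmoving : t < M ∧ -b ≤ m t
  · obtain ⟨htM, htb⟩ := hmoving
    have heq : ∀ s, t ≤ s → s ≤ M → q s = m s := fun s h1 h2 => by
      simp only [hq, min_eq_left h2]
      exact max_eq_left (htb.trans (hbound t s ht.le h1 h2).1)
    refine ⟨m, m' t, (hm t).hasDerivWithinAt, ?_, ?_⟩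
    · filter_upwards [key, self_mem_nhdsWithin,
        mem_nhdsWithin_of_mem_nhds (Iio_mem_nhds htM)] with s hs h1 h2
      rwa [heq s (le_of_lt h1) (le_of_lt h2), heq t le_rfl htM.le] at hs
    · change _ ≤ ((k t.toNNReal (σ (q t.toNNReal)) : ℝ≥0) : ℝ)
      rw [Real.coe_toNNReal _ ht.le, heq t le_rfl htM.le]
      exact hmk t ht.le htM.le htb
  · refine ⟨fun _ => 0, 0, hasDerivWithinAt_const _ _ _, ?_, NNReal.coe_nonneg _⟩
    have hconst : ∀ᶠ s in 𝓝[>] t, q s = q t := by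
      by_cases htM : M ≤ t
      · filter_upwards [self_mem_nhdsWithin] with s (hs : t < s)
        simp only [hq, min_eq_right htM, min_eq_right (htM.trans hs.le)]
      · push Not at htM
        have htb : m t < -b := by grind
        filter_upwards [mem_nhdsWithin_of_mem_nhds (Iio_mem_nhds htM), mem_nhdsWithin_of_mem_nhds
          ((hm t).continuousAt.eventually (gt_mem_nhds htb))] with s (h1 : s < M) h2
        simp only [hq, min_eq_left h1.le, min_eq_left htM.le]
        rw [max_eq_right htb.le, max_eq_right (le_of_lt h2)]
    filter_upwards [key, hconst] with s h1 h2
    rw [h2, sub_self] at h1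
    simpa using h1

/-! ### Comparison of two problems -/

/-- Comparison of the values of two nearby problems.  A `k₁`-admissible curve from `(t₁, x₁)` that
meets `Γ` at time `t₁ + τ` is turned into a `k₂`-admissible curve from `(t₂, x₂)` with the same
trace, preceded by a curve of length `b` from `x₂` to `x₁`.  If `ℓ` is the position of the first one
on the trace, the second one has position `m(t) = ℓ(t) - η e^{(L+1)t}`.  The growth of this delay
absorbs both the error `η` between `k₁` and `k₂` and the error `L η e^{(L+1)t}` caused by being at
another point, and the delay is made up after `Γ` would have been met, at speed `Kmin`.  The second
curve stands still after the horizon `M`, so the speeds matter only up to the time `M` and in a ball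
that no curve involved leaves before. -/
theorem valueFunction_le_add {X : Type*} [PseudoMetricSpace X]
    [TopologicalSpace.SeparableSpace X] {Γ : Set X} (hΓ : IsClosed Γ)
    {g : Γ → ℝ≥0} {Lg : ℝ≥0} (hg : LipschitzWith Lg g) {k₁ k₂ : ℝ≥0 → X → ℝ≥0}
    (hk₁ : Continuous fun p : ℝ≥0 × X => k₁ p.1 p.2)
    (hk₂ : Continuous fun p : ℝ≥0 × X => k₂ p.1 p.2) {Kmin Kmax : ℝ≥0} (hKmin : 0 < Kmin)
    (hmin₁ : ∀ t x, Kmin ≤ k₁ t x) (hmax₁ : ∀ t x, k₁ t x ≤ Kmax) (hmax₂ : ∀ t x, k₂ t x ≤ Kmax)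
    (hLgK : Lg * Kmax ≤ 1) {γ : C(ℝ≥0, X)} (hγ : γ ∈ Adm k₁) {t₁ t₂ τ : ℝ≥0}
    (hτ : γ (t₁ + τ) ∈ Γ) {b : ℝ} (hb : 0 ≤ b) {c : ℝ → X} (hcb : c b = γ t₁)
    (hc : ∀ s t, 0 ≤ s → s ≤ t → t ≤ b → dist (c s) (c t) ≤ t - s)
    {o : X} {R L η M : ℝ} (hL : 0 ≤ L)
    (hlip : ∀ u, ∀ y ∈ Metric.closedBall o R, ∀ z ∈ Metric.closedBall o R,
      |(k₁ u y : ℝ) - k₁ u z| ≤ L * dist y z)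
    (hclose : ∀ u : ℝ≥0, (u : ℝ) ≤ M → ∀ y ∈ Metric.closedBall o R, (k₁ u y : ℝ) ≤ k₂ u y + η)
    (hη : b + Kmax * |(t₁ : ℝ) - t₂| ≤ η) (hηK : (L + 1) * η * Real.exp ((L + 1) * M) ≤ Kmin)
    (hM : t₁ + τ + η * Real.exp ((L + 1) * M) / Kmin ≤ M)
    (hR : dist (γ t₁) o + b + Kmax * M ≤ R) :
    valueFunction Γ g k₂ t₂ (c 0) ≤ τ + g ⟨γ (t₁ + τ), hτ⟩ +
      ENNReal.ofReal (|(t₁ : ℝ) - t₂| + η * Real.exp ((L + 1) * M) / Kmin) := by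
  have hKmin' : (0 : ℝ) < Kmin := hKmin
  have hKK : (Kmin : ℝ) ≤ Kmax := NNReal.coe_le_coe.2 ((hmin₁ 0 (c 0)).trans (hmax₁ 0 (c 0)))
  obtain ⟨σ, ℓ, hσ, hσb, hℓ0, hℓ, hσℓ⟩ := exists_reparametrization hk₁ hKmin hmin₁ hγ t₁ hb hcb hc
  have hlow : ∀ s t, s ≤ t → Kmin * (t - s) ≤ ℓ t - ℓ s := fun s t hst =>
    mul_sub_le_image_sub_of_le_deriv (fun u => (hℓ u).differentiableAt)
      (fun u => by rw [(hℓ u).deriv]; exact NNReal.coe_le_coe.2 (hmin₁ _ _)) hst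
  have hupp : ∀ s t, s ≤ t → ℓ t - ℓ s ≤ Kmax * (t - s) := fun s t hst =>
    image_sub_le_mul_sub_of_deriv_le (fun u => (hℓ u).differentiableAt)
      (fun u => by rw [(hℓ u).deriv]; exact NNReal.coe_le_coe.2 (hmax₁ _ _)) hst
  have hmono : ∀ s t, s ≤ t → ℓ s ≤ ℓ t := fun s t hst => by
    have := hlow s t hst
    have h2 : (0 : ℝ) ≤ Kmin * (t - s) := mul_nonneg hKmin'.le (sub_nonneg.2 hst)
    linarith
  have hδ0 : 0 ≤ Kmax * |(t₁ : ℝ) - t₂| := by positivity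
  have hη0 : 0 ≤ η := by linarith
  set E := Real.exp ((L + 1) * M) with hE
  have hh0 : 0 ≤ η * E / Kmin := by positivity
  have hM0 : 0 ≤ M := by
    have h1 := t₁.coe_nonneg
    have h2 := τ.coe_nonneg
    linarith
  have hexp1 : ∀ t : ℝ, 0 ≤ t → 1 ≤ Real.exp ((L + 1) * t) := fun t ht =>
    Real.one_le_exp (by positivity)
  have hexpE : ∀ t : ℝ, t ≤ M → Real.exp ((L + 1) * t) ≤ E := fun t ht =>
    Real.exp_le_exp.2 (by gcongr)
  set e : ℝ → ℝ := fun t => η * Real.exp ((L + 1) * t) with he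
  have heη : ∀ t : ℝ, 0 ≤ t → η ≤ e t := fun t ht => le_mul_of_one_le_right hη0 (hexp1 t ht)
  have heE : ∀ t : ℝ, t ≤ M → e t ≤ η * E := fun t ht =>
    mul_le_mul_of_nonneg_left (hexpE t ht) hη0
  have hder : ∀ t, HasDerivAt e ((L + 1) * e t) t := fun t => by
    have h1 : HasDerivAt (fun t : ℝ => (L + 1) * t) (L + 1) t := by
      simpa using (hasDerivAt_id t).const_mul (L + 1)
    refine ((h1.exp).const_mul η).congr_deriv ?_
    simp only [he]
    ring
  set m : ℝ → ℝ := fun t => ℓ t - e t with hm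
  have hσd : ∀ r s, dist (σ r) (σ s) ≤ |r - s| := fun r s => by
    simpa [Real.dist_eq] using hσ.dist_le_mul r s
  have hσ0 : σ 0 = γ t₁ := by
    have := hσℓ t₁ le_rfl
    rwa [hℓ0] at this
  have hball : ∀ r, -b ≤ r → r ≤ Kmax * M → σ r ∈ Metric.closedBall o R := by
    intro r h1 h2
    have h3 := hσd r 0
    have h4 := dist_triangle (σ r) (σ 0) o
    have h5 : |r - 0| ≤ b + Kmax * M := by
      rw [sub_zero, abs_le]
      have : (0 : ℝ) ≤ Kmax * M := by positivity
      constructor <;> linarith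
    rw [hσ0] at h3 h4
    rw [Metric.mem_closedBall]
    linarith
  have hℓM : ∀ t : ℝ, 0 ≤ t → t ≤ M → ℓ t ≤ Kmax * M := by
    intro t h0 h1
    rcases le_total t t₁ with h | h
    · have h2 := hmono _ _ h
      have : (0 : ℝ) ≤ Kmax * M := by positivity
      linarith
    · have h2 := hupp _ _ h
      have h3 : (Kmax : ℝ) * (t - t₁) ≤ Kmax * M := by
        gcongr
        have := t₁.coe_nonneg
        linarith
      linarith
  set κ : ℝ → ℝ := fun t => k₁ (max t (t₁ : ℝ)).toNNReal (γ (max t (t₁ : ℝ)).toNNReal) with hκ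
  have hmder : ∀ t, HasDerivAt m (κ t - (L + 1) * e t) t := fun t => (hℓ t).sub (hder t)
  have hm'0 : ∀ t, 0 ≤ t → t ≤ M → 0 ≤ κ t - (L + 1) * e t := by
    intro t _ ht
    have h1 : (Kmin : ℝ) ≤ κ t := NNReal.coe_le_coe.2 (hmin₁ _ _)
    have h2 : (L + 1) * e t ≤ (L + 1) * (η * E) := by
      gcongr
      exact heE t ht
    linarith
  have hm'K : ∀ t, 0 ≤ t → t ≤ M → κ t - (L + 1) * e t ≤ Kmax := by
    intro t ht _
    have h1 : κ t ≤ Kmax := NNReal.coe_le_coe.2 (hmax₁ _ _)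
    have h2 : 0 ≤ (L + 1) * e t := mul_nonneg (by linarith) (hη0.trans (heη t ht))
    linarith
  have hm'k : ∀ t, 0 ≤ t → t ≤ M → -b ≤ m t →
      κ t - (L + 1) * e t ≤ k₂ t.toNNReal (σ (m t)) := by
    intro t ht htM htb
    change -b ≤ ℓ t - e t at htb
    change _ ≤ ((k₂ t.toNNReal (σ (ℓ t - e t)) : ℝ≥0) : ℝ)
    have h1 := heη t ht
    have hℓt : 0 ≤ ℓ t := by linarith
    -- Since `b ≤ η ≤ e t`, the position `m t` is at least `-b` only after time `t₁`, where `ℓ` describes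
    -- the first curve.
    have htt : (t₁ : ℝ) ≤ t := by
      by_contra hlt
      push Not at hlt
      have h2 := hlow _ _ hlt.le
      have h3 : (0 : ℝ) < Kmin * (t₁ - t) := mul_pos hKmin' (sub_pos.2 hlt)
      linarith
    have hσt : σ (ℓ t) = γ t.toNNReal := by
      have := hσℓ t.toNNReal (NNReal.le_toNNReal_of_coe_le htt)
      rwa [Real.coe_toNNReal _ ht] at this
    have hκt : κ t = k₁ t.toNNReal (σ (ℓ t)) := by simp only [hκ, max_eq_left htt, hσt]
    have hb1 := hball (ℓ t) (by linarith) (hℓM t ht htM)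
    have hb2 := hball (ℓ t - e t) htb (by linarith [hℓM t ht htM])
    have h2 := (le_abs_self _).trans (hlip t.toNNReal _ hb1 _ hb2)
    have h3 := hclose t.toNNReal (by rwa [Real.coe_toNNReal _ ht]) _ hb2
    have h4 : L * dist (σ (ℓ t)) (σ (ℓ t - e t)) ≤ L * e t := by
      gcongr
      refine (hσd _ _).trans (le_of_eq ?_)
      rw [sub_sub_cancel, abs_of_nonneg (hη0.trans h1)]
    linarith
  obtain ⟨γ', hγ', hγ'eq⟩ := exists_mem_Adm_of_position hσ hM0 hmder hm'0 hm'K hm'k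
  -- The second curve starts at `x₂` at time `t₂` and meets `Γ` at the same point as the first one.
  set S : ℝ := t₁ + τ + η * E / Kmin with hS
  have ht₂S : (t₂ : ℝ) ≤ S := by
    have h1 : |(t₁ : ℝ) - t₂| ≤ η * E / Kmin := by
      rw [le_div_iff₀ hKmin']
      have h2 : |(t₁ : ℝ) - t₂| * Kmin ≤ |(t₁ : ℝ) - t₂| * Kmax := by gcongr
      have h3 : η ≤ η * E := le_mul_of_one_le_right hη0 (hexp1 M hM0)
      linarith
    have h2 := neg_abs_le ((t₁ : ℝ) - t₂)
    have h3 := τ.coe_nonneg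
    linarith
  have hmt₂ : m t₂ ≤ -b := by
    have h1 : ℓ t₂ ≤ Kmax * |(t₁ : ℝ) - t₂| := by
      rcases le_total (t₂ : ℝ) t₁ with h | h
      · have := hmono _ _ h
        linarith
      · have := hupp _ _ h
        rw [abs_sub_comm, abs_of_nonneg (sub_nonneg.2 h)]
        linarith
    have h2 := heη t₂ t₂.coe_nonneg
    simp only [hm]
    linarith
  have ha0 : 0 ≤ ℓ (t₁ + τ) := by
    have h1 := hmono t₁ (t₁ + τ) (le_add_of_nonneg_right τ.coe_nonneg)
    linarith
  have hmS : ℓ (t₁ + τ) ≤ m S := by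
    have h1 := hlow (t₁ + τ) S (le_add_of_nonneg_right hh0)
    rw [hS, add_sub_cancel_left, mul_div_cancel₀ _ hKmin'.ne', ← hS] at h1
    have h2 := heE S hM
    simp only [hm]
    linarith
  have hmcont : Continuous m := continuous_iff_continuousAt.2 fun t => (hmder t).continuousAt
  obtain ⟨s, hs, hms⟩ := intermediate_value_Icc ht₂S hmcont.continuousOn
    (⟨by linarith, hmS⟩ : ℓ (t₁ + τ) ∈ Icc (m t₂) (m S))
  set h : ℝ≥0 := (s - t₂).toNNReal with hh
  have hhs : ((t₂ + h : ℝ≥0) : ℝ) = s := by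
    rw [NNReal.coe_add, hh, Real.coe_toNNReal _ (sub_nonneg.2 hs.1)]
    ring
  have hstart : γ' t₂ = c 0 := by
    rw [hγ'eq, min_eq_left (ht₂S.trans hM)]
    rw [← hσb]
    exact congrArg σ (max_eq_right hmt₂)
  have hend : γ' (t₂ + h) = γ (t₁ + τ) := by
    rw [hγ'eq, hhs, min_eq_left (hs.2.trans hM)]
    rw [hms, max_eq_left (by linarith)]
    have := hσℓ (t₁ + τ) (le_add_of_nonneg_right zero_le)
    rwa [NNReal.coe_add] at this
  have hmem : γ' (t₂ + h) ∈ Γ := hend ▸ hτ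
  have hfin := valueFunction_le_of_mem hΓ hg hk₂ hmax₂ hLgK hγ' hmem
  rw [hstart] at hfin
  simp only [hend] at hfin
  refine hfin.trans ?_
  rw [add_right_comm]
  gcongr
  rw [← ENNReal.ofReal_coe_nnreal (p := τ), ← ENNReal.ofReal_add τ.coe_nonneg (by positivity),
    ← ENNReal.ofReal_coe_nnreal (p := h)]
  refine ENNReal.ofReal_le_ofReal ?_
  rw [hh, Real.coe_toNNReal _ (sub_nonneg.2 hs.1)]
  have h1 := le_abs_self ((t₁ : ℝ) - t₂)
  have h2 := hs.2
  linarith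

end MFGExit

/-! ### Continuity of the value function -/

theorem proposition4p13 {X : Type*} [MetricSpace X] [MeasurableSpace X] [BorelSpace X]
    [MeasurableSpace C(ℝ≥0, X)] [BorelSpace C(ℝ≥0, X)]
    (o : X) (Γ : Set X) (g : Γ → ℝ≥0) (K : ProbabilityMeasure X → X → ℝ≥0)
    (Lg Kmin Kmax D : ℝ≥0)
    -- closed balls are compact
    (hX : ∀ R : ℝ, 0 < R → IsCompact (Metric.closedBall o R))
    -- target set
    (hΓ : Γ.Nonempty) (hΓc : IsClosed Γ)
    -- exit cost
    (hg : LipschitzWith Lg g)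
    -- distance dominates length of unit-speed connecting curves
    (hD : 0 < D)
    (hcurve : ∀ x y : X, ∃ T : ℝ, 0 ≤ T ∧ T ≤ D * dist x y ∧ ∃ c : ℝ → X,
      (∃ C : ℝ≥0, LipschitzOnWith C c (Icc 0 T)) ∧ c 0 = x ∧ c T = y ∧
      ∀ᵐ t : ℝ ∂(volume.restrict (Ioo 0 T)), MFGExit.HasMetricDerivAt c 1 t)
    -- maximal speed
    (hK : Continuous fun p : ProbabilityMeasure X × X => K p.1 p.2)
    (hKmin : 0 < Kmin) (hKmax : 0 < Kmax)
    (hKbd : ∀ μ x, Kmin ≤ K μ x ∧ K μ x ≤ Kmax)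
    -- local Lipschitz continuity in space, uniformly in the measure
    (hKlip : ∀ R : ℝ, 0 < R → ∃ L : ℝ, 0 < L ∧ ∀ μ : ProbabilityMeasure X,
      ∀ x₁ ∈ Metric.closedBall o R, ∀ x₂ ∈ Metric.closedBall o R,
        |(K μ x₁ : ℝ) - (K μ x₂ : ℝ)| ≤ L * dist x₁ x₂)
    -- smallness of the Lipschitz constant of the exit cost
    (hLgK : Lg * Kmax < 1) :
    (∀ (t : ℝ≥0) (x : X) (Q : ProbabilityMeasure C(ℝ≥0, X)),
      MFGExit.inducedValue Γ g K Q t x ≠ ∞) ∧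
    Continuous fun p : ℝ≥0 × X × ProbabilityMeasure C(ℝ≥0, X) =>
      MFGExit.inducedValue Γ g K p.2.2 p.1 p.2.1 := by
  have hKmin' : (0 : ℝ) < Kmin := hKmin
  have hproper : ProperSpace X := ProperSpace.of_seq_closedBall (x := o) (l := atTop)
    tendsto_id ((eventually_gt_atTop 0).mono hX)
  have hcurve' : ∀ x y : X, ∃ T : ℝ, 0 ≤ T ∧ T ≤ D * dist x y ∧ ∃ c : ℝ → X, c 0 = x ∧ c T = y ∧
      ∀ s t, 0 ≤ s → s ≤ t → t ≤ T → dist (c s) (c t) ≤ t - s := by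
    intro x y
    obtain ⟨T, hT0, hT, c, ⟨C, hC⟩, hx, hy, hd⟩ := hcurve x y
    exact ⟨T, hT0, hT, c, hx, hy, fun s t hs hst ht =>
      MFGExit.dist_le_sub_of_metricDeriv_eq_one hC hd hs hst ht⟩
  have hkQ : Continuous fun q : ProbabilityMeasure C(ℝ≥0, X) × (ℝ≥0 × X) =>
      K (MFGExit.marginal q.1 q.2.1) q.2.2 :=
    hK.comp ((MFGExit.continuous_marginal.comp
      (by fun_prop : Continuous fun q : ProbabilityMeasure C(ℝ≥0, X) × (ℝ≥0 × X) =>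
        (q.2.1, q.1))).prodMk (by fun_prop))
  have hk : ∀ Q : ProbabilityMeasure C(ℝ≥0, X),
      Continuous fun p : ℝ≥0 × X => K (MFGExit.marginal Q p.1) p.2 := fun Q =>
    hkQ.comp (continuous_const.prodMk continuous_id)
  obtain ⟨p, hp⟩ := hΓ
  have hbound : ∀ (t : ℝ≥0) (x : X) (Q : ProbabilityMeasure C(ℝ≥0, X)),
      MFGExit.inducedValue Γ g K Q t x ≤ ENNReal.ofReal (D * dist x p / Kmin + g ⟨p, hp⟩) := by
    intro t x Q
    obtain ⟨b, hb0, hb, c, hcx, hcp, hc⟩ := hcurve' x p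
    refine (MFGExit.valueFunction_le_of_curve hΓc hg (hk Q) hKmin (fun _ _ => (hKbd _ _).1)
      (fun _ _ => (hKbd _ _).2) hLgK.le t hp hb0 hcx hcp hc).trans ?_
    rw [ENNReal.ofReal_add (by positivity) (NNReal.coe_nonneg _), ENNReal.ofReal_coe_nnreal]
    gcongr
  have hfin : ∀ (t : ℝ≥0) (x : X) (Q : ProbabilityMeasure C(ℝ≥0, X)),
      MFGExit.inducedValue Γ g K Q t x ≠ ∞ := fun t x Q =>
    ne_top_of_le_ne_top ENNReal.ofReal_ne_top (hbound t x Q)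
  refine ⟨hfin, continuous_iff_continuousAt.2 fun ⟨t₀, x₀, Q₀⟩ => ?_⟩
  rw [ContinuousAt, ENNReal.tendsto_nhds (hfin _ _ _)]
  intro ε' hε'
  obtain ⟨ε, hε0, hε1, hεε'⟩ : ∃ ε : ℝ, 0 < ε ∧ ε ≤ 1 ∧ ENNReal.ofReal ε ≤ ε' := by
    have hne : min ε' 1 ≠ ∞ := ne_top_of_le_ne_top ENNReal.one_ne_top (min_le_right _ _)
    refine ⟨(min ε' 1).toReal, ENNReal.toReal_pos (lt_min hε' one_pos).ne' hne, ?_, ?_⟩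
    · exact ENNReal.toReal_mono ENNReal.one_ne_top (min_le_right _ _)
    · rw [ENNReal.ofReal_toReal hne]
      exact min_le_left _ _
  -- A common bound of the values near the base point, hence a common time horizon `M` and a common
  -- ball for all nearly optimal curves.
  set C₀ : ℝ := D * (dist x₀ p + 1) / Kmin + g ⟨p, hp⟩ with hC₀
  have hC₀0 : 0 ≤ C₀ := by positivity
  set M : ℝ := t₀ + C₀ + 3 with hM
  have hM0 : 0 ≤ M := by positivity
  set R : ℝ := dist x₀ o + 2 + Kmax * M with hR
  obtain ⟨L, hL0, hL⟩ := hKlip R (by positivity)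
  set E : ℝ := Real.exp ((L + 1) * M) with hE
  have hE0 : 0 < E := Real.exp_pos _
  obtain ⟨η, hη0, hη1, hηε, hηL⟩ : ∃ η : ℝ, 0 < η ∧ η ≤ 1 ∧ η * E / Kmin ≤ ε / 3 ∧
      (L + 1) * η * E ≤ Kmin := by
    refine ⟨min 1 (min (ε / 3 * Kmin / E) (Kmin / ((L + 1) * E))), by positivity,
      min_le_left _ _, ?_, ?_⟩
    · rw [div_le_iff₀ hKmin', ← le_div_iff₀ hE0]
      exact (min_le_right _ _).trans (min_le_left _ _)
    · rw [mul_right_comm, mul_comm, ← le_div_iff₀ (by positivity)]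
      exact (min_le_right _ _).trans (min_le_right _ _)
  have hcomp : ∀ (t₁ t₂ : ℝ≥0) (x₁ x₂ : X) (Q₁ Q₂ : ProbabilityMeasure C(ℝ≥0, X)),
      (t₁ : ℝ) ≤ t₀ + 1 → dist x₁ x₀ ≤ 1 → D * dist x₂ x₁ + Kmax * |(t₁ : ℝ) - t₂| ≤ η →
      |(t₁ : ℝ) - t₂| ≤ ε / 3 →
      (∀ u : ℝ≥0, (u : ℝ) ≤ M → ∀ y ∈ Metric.closedBall o R,
        (K (MFGExit.marginal Q₁ u) y : ℝ) ≤ K (MFGExit.marginal Q₂ u) y + η) →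
      MFGExit.inducedValue Γ g K Q₂ t₂ x₂ ≤
        MFGExit.inducedValue Γ g K Q₁ t₁ x₁ + ENNReal.ofReal ε := by
    intro t₁ t₂ x₁ x₂ Q₁ Q₂ ht hx hxt htt hclose
    have hlt : MFGExit.inducedValue Γ g K Q₁ t₁ x₁ <
        MFGExit.inducedValue Γ g K Q₁ t₁ x₁ + ENNReal.ofReal (ε / 3) :=
      ENNReal.lt_add_right (hfin _ _ _) (by simpa using hε0)
    obtain ⟨γ, hγ, hγx, τ, hτ, hcost⟩ := MFGExit.exists_of_valueFunction_lt hΓc hlt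
    change _ < MFGExit.inducedValue Γ g K Q₁ t₁ x₁ + _ at hcost
    have hτC : (τ : ℝ) ≤ C₀ + 1 := by
      have h1 : dist x₁ p ≤ dist x₀ p + 1 := by
        have := dist_triangle x₁ x₀ p
        linarith
      have h2 : MFGExit.inducedValue Γ g K Q₁ t₁ x₁ ≤ ENNReal.ofReal C₀ :=
        (hbound _ _ _).trans (ENNReal.ofReal_le_ofReal (by rw [hC₀]; gcongr))
      have h3 : (τ : ℝ≥0∞) ≤ ENNReal.ofReal (C₀ + 1) := by
        rw [ENNReal.ofReal_add hC₀0 zero_le_one]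
        refine le_self_add.trans (hcost.le.trans (add_le_add h2 (ENNReal.ofReal_le_ofReal ?_)))
        linarith
      rw [← ENNReal.ofReal_coe_nnreal] at h3
      exact (ENNReal.ofReal_le_ofReal_iff (by linarith)).1 h3
    obtain ⟨b, hb0, hb, c, hcx, hcp, hc⟩ := hcurve' x₂ x₁
    have hKt : 0 ≤ Kmax * |(t₁ : ℝ) - t₂| := by positivity
    have hmain := MFGExit.valueFunction_le_add hΓc hg (hk Q₁) (hk Q₂) hKmin
      (fun _ _ => (hKbd _ _).1) (fun _ _ => (hKbd _ _).2) (fun _ _ => (hKbd _ _).2) hLgK.le hγ hτ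
      hb0 (hcp.trans hγx.symm) hc hL0.le (fun u => hL _) hclose (t₂ := t₂) (by linarith) hηL
      (by linarith) (by
        rw [hγx]
        have := dist_triangle x₁ x₀ o
        linarith)
    rw [hcx] at hmain
    refine hmain.trans ?_
    calc (τ : ℝ≥0∞) + g ⟨γ (t₁ + τ), hτ⟩ + ENNReal.ofReal (|(t₁ : ℝ) - t₂| + η * E / Kmin)
        ≤ MFGExit.inducedValue Γ g K Q₁ t₁ x₁ + ENNReal.ofReal (ε / 3) +
          ENNReal.ofReal (ε / 3 + ε / 3) := by gcongr
      _ = MFGExit.inducedValue Γ g K Q₁ t₁ x₁ + ENNReal.ofReal ε := by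
          rw [add_assoc, ← ENNReal.ofReal_add (by positivity) (by positivity)]
          ring_nf
  have hspeed : ∀ᶠ q : ℝ≥0 × X × ProbabilityMeasure C(ℝ≥0, X) in 𝓝 (t₀, x₀, Q₀),
      ∀ z ∈ Icc 0 M.toNNReal ×ˢ Metric.closedBall o R,
        |(K (MFGExit.marginal q.2.2 z.1) z.2 : ℝ) - K (MFGExit.marginal Q₀ z.1) z.2| < η := by
    have hcpt : IsCompact (Icc 0 M.toNNReal ×ˢ Metric.closedBall o R) :=
      isCompact_Icc.prod (isCompact_closedBall o R)
    have := hcpt.eventually_forall_of_forall_eventually (x₀ := Q₀) (P := fun Q z =>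
      |(K (MFGExit.marginal Q z.1) z.2 : ℝ) - K (MFGExit.marginal Q₀ z.1) z.2| < η) ?_
    · exact (continuous_snd.snd.tendsto (t₀, x₀, Q₀)).eventually this
    · intro z _
      have hc : Continuous fun w : ProbabilityMeasure C(ℝ≥0, X) × (ℝ≥0 × X) =>
          |(K (MFGExit.marginal w.1 w.2.1) w.2.2 : ℝ) - K (MFGExit.marginal Q₀ w.2.1) w.2.2| :=
        ((NNReal.continuous_coe.comp hkQ).sub
          (NNReal.continuous_coe.comp ((hk Q₀).comp continuous_snd))).abs
      refine (hc.tendsto (Q₀, z)).eventually (gt_mem_nhds ?_)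
      simpa using hη0
  have hpos : ∀ᶠ q : ℝ≥0 × X × ProbabilityMeasure C(ℝ≥0, X) in 𝓝 (t₀, x₀, Q₀),
      D * dist q.2.1 x₀ + Kmax * |(q.1 : ℝ) - t₀| < η := by
    have hc : Continuous fun q : ℝ≥0 × X × ProbabilityMeasure C(ℝ≥0, X) =>
      (D : ℝ) * dist q.2.1 x₀ + Kmax * |(q.1 : ℝ) - t₀| := by fun_prop
    exact (hc.tendsto (t₀, x₀, Q₀)).eventually (gt_mem_nhds (by simpa using hη0))
  have hdist : ∀ᶠ q : ℝ≥0 × X × ProbabilityMeasure C(ℝ≥0, X) in 𝓝 (t₀, x₀, Q₀),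
      dist q.2.1 x₀ < 1 := by
    have hc : Continuous fun q : ℝ≥0 × X × ProbabilityMeasure C(ℝ≥0, X) => dist q.2.1 x₀ := by
      fun_prop
    exact (hc.tendsto (t₀, x₀, Q₀)).eventually (gt_mem_nhds (by simp))
  have htime : ∀ᶠ q : ℝ≥0 × X × ProbabilityMeasure C(ℝ≥0, X) in 𝓝 (t₀, x₀, Q₀),
      |(q.1 : ℝ) - t₀| < ε / 3 := by
    have hc : Continuous fun q : ℝ≥0 × X × ProbabilityMeasure C(ℝ≥0, X) =>
      |(q.1 : ℝ) - t₀| := by fun_prop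
    exact (hc.tendsto (t₀, x₀, Q₀)).eventually (gt_mem_nhds (by simpa using hε0))
  filter_upwards [hspeed, hpos, hdist, htime] with ⟨t, x, Q⟩ h1 h2 h3 h4
  simp only at h1 h2 h3 h4
  have h1' : ∀ u : ℝ≥0, (u : ℝ) ≤ M → ∀ y ∈ Metric.closedBall o R,
      |(K (MFGExit.marginal Q u) y : ℝ) - K (MFGExit.marginal Q₀ u) y| < η := fun u hu y hy =>
    h1 (u, y) ⟨⟨zero_le, NNReal.le_toNNReal_of_coe_le hu⟩, hy⟩
  constructor
  · rw [tsub_le_iff_right]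
    refine (hcomp t t₀ x x₀ Q Q₀ ?_ h3.le ?_ h4.le fun u hu y hy => ?_).trans (by gcongr)
    · have := le_abs_self ((t : ℝ) - t₀)
      linarith
    · rw [dist_comm]
      exact h2.le
    · have := le_abs_self ((K (MFGExit.marginal Q u) y : ℝ) - K (MFGExit.marginal Q₀ u) y)
      linarith [h1' u hu y hy]
  · refine (hcomp t₀ t x₀ x Q₀ Q ?_ ?_ ?_ ?_ fun u hu y hy => ?_).trans (by gcongr)
    · linarith
    · simp
    · rw [abs_sub_comm]
      exact h2.le
    · rw [abs_sub_comm]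
      exact h4.le
    · have := neg_abs_le ((K (MFGExit.marginal Q u) y : ℝ) - K (MFGExit.marginal Q₀ u) y)
      linarith [h1' u hu y hy]
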